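/- Let $K$ be a field of characteristic $0$ with algebraic closure $\overline K$. A Puiseux series over $\overline K$ is a formal series $\phi(X)=\sum_{t\ge t_0} f_t X^{t/d}$ with $t_0\in\mathbb Z$, $d\in\mathbb Z_{\ge 1}$ and $f_t\in\overline K$; if $\phi\neq 0$, its valuation $\operatorname{val}(\phi)\in\mathbb Q$ is its least exponent with nonzero coefficient, and $\operatorname{val}(0)=+\infty$. Let $\phi$ be a nonzero Puiseux series over $\overline K$ of valuation $v$, algebraic over $K(X)$, and let $g\in K[X,Y]$ be its minimal polynomial, i.e. $g$ is irreducible in $K[X,Y]$ and $g(X,\phi(X))=0$. Let $(d_X,d_Y)$ be the bidegree of $g$, that is $d_X=\deg_X g$ and $d_Y=\deg_Y g$. Let $\ell\ge 1$ and let $$f=\sum_{j=1}^{\ell} c_j X^{\alpha_j}Y^{\beta_j}\in K[X,Y]$$ be a polynomial with exactly $\ell$ terms (that is, the $c_j\in K$ are nonzero and the pairs $(\alpha_j,\beta_j)\in\mathbb Z_{\ge 0}^2$ are pairwise distinct). Suppose that the family $(X^{\alpha_j}\phi(X)^{\beta_j})_{1\le j\le \ell}$ is linearly independent over $K$. Then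 $$\operatorname{val}\bigl(f(X,\phi(X))\bigr)\le \min_{1\le j\le \ell}(\alpha_j+v\beta_j)+\gamma_v(\ell),$$ where $$\gamma_v(\ell)=4d_Xd_Y(\ell-1)^2-\tfrac12(\ell-1)\bigl((3\ell-4)d_X+v\ell\bigr).$$ -/

import Mathlib

open Polynomial
open scoped Polynomial.Bivariate

noncomputable section

/-- The ring of Puiseux series with coefficients in `L`, inside the Hahn series with rational
exponents: the series whose exponents all lie in `(1/d) ℤ` for some integer `d ≥ 1`.
(The support of a Hahn series is well-ordered, so inside `(1/d) ℤ` it is bounded below, and the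
elements are exactly the series `∑_{t ≥ t₀} f_t X^{t/d}`.) -/
def PuiseuxSeries (L : Type*) [Field L] : Subring (HahnSeries ℚ L) where
  carrier := {φ | ∃ d : ℕ, 0 < d ∧ ∀ q ∈ φ.support, ∃ t : ℤ, q = t / d}
  mul_mem' := by
    rintro φ ψ ⟨d, hd, hφ⟩ ⟨e, he, hψ⟩
    refine ⟨d * e, Nat.mul_pos hd he, fun q hq => ?_⟩
    obtain ⟨a, ha, b, hb, rfl⟩ := HahnSeries.support_mul_subset hq
    obtain ⟨s, rfl⟩ := hφ a ha
    obtain ⟨t, rfl⟩ := hψ b hb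
    have hd' : (d : ℚ) ≠ 0 := by positivity
    have he' : (e : ℚ) ≠ 0 := by positivity
    refine ⟨s * e + t * d, ?_⟩
    push_cast
    field_simp
  add_mem' := by
    rintro φ ψ ⟨d, hd, hφ⟩ ⟨e, he, hψ⟩
    have hd' : (d : ℚ) ≠ 0 := by positivity
    have he' : (e : ℚ) ≠ 0 := by positivity
    refine ⟨d * e, Nat.mul_pos hd he, fun q hq => ?_⟩
    rcases HahnSeries.support_add_subset φ ψ hq with h | h
    · obtain ⟨s, rfl⟩ := hφ q h
      refine ⟨s * e, ?_⟩
      push_cast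
      field_simp
    · obtain ⟨t, rfl⟩ := hψ q h
      refine ⟨t * d, ?_⟩
      push_cast
      field_simp
  zero_mem' := ⟨1, one_pos, fun q hq => by simp at hq⟩
  one_mem' := ⟨1, one_pos, fun q hq =>
    ⟨0, by simpa using HahnSeries.eq_of_mem_support_single hq⟩⟩
  neg_mem' := by
    rintro φ ⟨d, hd, hφ⟩
    exact ⟨d, hd, fun q hq => hφ q (by simpa using hq)⟩

namespace PuiseuxSeries

/-- Constants, viewed as Puiseux series. -/
def const (L : Type*) [Field L] : L →+* PuiseuxSeries L :=
  (HahnSeries.C : L →+* HahnSeries ℚ L).codRestrict (PuiseuxSeries L) fun r =>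
    ⟨1, one_pos, fun q hq => ⟨0, by simpa using HahnSeries.eq_of_mem_support_single hq⟩⟩

variable {K L : Type*} [Field K] [Field L] [Algebra K L]

/-- Elements of `K` act as constants, through `K → L`. -/
instance instAlgebra : Algebra K (PuiseuxSeries L) :=
  ((const L).comp (algebraMap K L)).toAlgebra

/-- The series `X`. -/
def X : PuiseuxSeries L :=
  ⟨HahnSeries.single 1 1, 1, one_pos, fun q hq =>
    ⟨1, by simpa using HahnSeries.eq_of_mem_support_single hq⟩⟩

/-- The valuation of a Puiseux series: its least exponent, and `⊤` for the zero series. -/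
def val (φ : PuiseuxSeries L) : WithTop ℚ :=
  (φ : HahnSeries ℚ L).orderTop

/-- `h(X, φ(X))` for a bivariate polynomial `h ∈ K[X, Y]`. -/
def subst (h : K[X][Y]) (φ : PuiseuxSeries L) : PuiseuxSeries L :=
  h.aevalAeval X φ

/-- `g ∈ K[X, Y]` is the minimal polynomial of `φ` (which is unique up to a nonzero constant of
`K`): it is irreducible in `K[X, Y]` and `g(X, φ(X)) = 0`. -/
def IsMinimalPolynomial (g : K[X][Y]) (φ : PuiseuxSeries L) : Prop :=
  Irreducible g ∧ subst g φ = 0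

end PuiseuxSeries

/-- The degree in `X` of a bivariate polynomial. The degree in `Y` is `natDegree`. -/
def degX {K : Type*} [Field K] (g : K[X][Y]) : ℕ :=
  g.support.sup fun j => (g.coeff j).natDegree

/-- The quantity `γ_v(ℓ) = 4 d_X d_Y (ℓ-1)² - ½ (ℓ-1) ((3ℓ-4) d_X + v ℓ)`. -/
def gammaBound (dX dY : ℕ) (v : ℚ) (ℓ : ℕ) : ℚ :=
  4 * dX * dY * ((ℓ : ℚ) - 1) ^ 2 -
    1 / 2 * ((ℓ : ℚ) - 1) * ((3 * (ℓ : ℚ) - 4) * dX + v * ℓ)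

end

/-! The argument takes place in the field of Hahn series over `L`, with the derivation `D = X d/dX`.
It does not lower valuations and its constants are exactly `L`. If monomials `f_k = X^α_k φ^β_k` are
independent over `L`, their Wronskian is nonzero. Cramer's rule, after dividing every column by its
own function, gives `val F ≤ val f_j + val (det A)` for `F = ∑ c_k f_k` with `c_j ≠ 0`, where `A`
has entries `D^i f_k / f_k` (`addVal_sum_le_of_det_logIterate`). These entries are rational in `(X,
φ)`: with `q = Y ∂g/∂Y`, the determinant is a numerator of controlled bidegree over `q(X,
φ)^((n-1)^2)`. The resultant of the numerator with `g` bounds its valuation (`addVal_evalAt_le`),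
whence a bound `C (n-1)^2` on the gap (`addVal_sum_le`). Independence over `K` may be lost over `L`,
but it makes every nonempty partial sum of `f(X, φ)` nonzero, and this suffices because `C (n-1)^2`
is superadditive (`addVal_sum_le_of_subsums_ne_zero`). Likewise `g` may split over `L`, and is
replaced by an irreducible factor vanishing at `φ`. Finally `|v| ≤ d_X` turns the constant `C` into
`γ_v`. -/

noncomputable section

/-! ### Wronskians in a differential field. -/

/-- In a field with a derivation whose constants are `C`, a family which is linearly independent
over `C` has linearly independent columns of iterated derivatives. -/
theorem Derivation.eq_zero_of_sum_mul_iterate_eq_zero {C H ι : Type*} [Field C] [Field H]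
    [Algebra C H] (D : Derivation C H H) (hD : ∀ x, D x = 0 → ∃ c, algebraMap C H c = x)
    (f : ι → H) (s : Finset ι) (hf : LinearIndepOn C f (s : Set ι)) (h : ι → H)
    (hh : ∀ i < s.card, ∑ j ∈ s, h j * D^[i] (f j) = 0) : ∀ j ∈ s, h j = 0 := by
  classical
  induction s using Finset.strongInduction generalizing h with
  | H s ih =>
    by_contra! hne
    obtain ⟨k, hk, hk0⟩ := hne
    have hcard : (s.erase k).card + 1 = s.card := Finset.card_erase_add_one hk
    -- With the `k`-th coefficient normalised to 1, differentiating row `i` and subtracting row `i +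
    -- 1` leaves a shorter relation among the `D (h' j)`. By induction all `h' j` are constants,
    -- contradicting independence.
    set h' : ι → H := fun j => h j / h k with hh'
    have hh1 : ∀ i < s.card, ∑ j ∈ s, h' j * D^[i] (f j) = 0 := fun i hi => by
      have := hh i hi
      simp only [hh', div_mul_eq_mul_div, ← Finset.sum_div, this, zero_div]
    have h'k : h' k = 1 := div_self hk0
    have hD1 : ∀ j ∈ s, D (h' j) = 0 := by
      have key := ih (s.erase k) (Finset.erase_ssubset hk)
        (hf.mono (by simp)) (fun j => D (h' j)) (fun i hi => by
          have h1 := congrArg D (hh1 i (by omega))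
          have h2 := hh1 (i + 1) (by omega)
          simp only [Function.iterate_succ_apply'] at h2
          simp only [map_sum, Derivation.leibniz, smul_eq_mul, Finset.sum_add_distrib, h2,
            zero_add, map_zero] at h1
          rw [← Finset.add_sum_erase _ _ hk, h'k] at h1
          simpa [mul_comm] using h1)
      intro j hj
      by_cases hjk : j = k
      · simp [hjk, h'k]
      · exact key j (Finset.mem_erase.2 ⟨hjk, hj⟩)
    choose! c hc using fun j (hj : j ∈ s) => hD _ (hD1 j hj)
    have h0 := hh1 0 (Finset.card_pos.2 ⟨k, hk⟩)
    have h1 : ∑ j ∈ s, c j • f j = 0 := by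
      rw [← h0]
      exact Finset.sum_congr rfl fun j hj => by rw [Algebra.smul_def, hc j hj]; rfl
    have h2 := (linearIndepOn_finset_iff.1 hf) c h1 k hk
    have h3 := hc k hk
    rw [h2, h'k, map_zero] at h3
    exact zero_ne_one h3

theorem Derivation.det_iterate_ne_zero {C H : Type*} [Field C] [Field H]
    [Algebra C H] (D : Derivation C H H) (hD : ∀ x, D x = 0 → ∃ c, algebraMap C H c = x)
    {n : ℕ} (f : Fin n → H) (hf : LinearIndependent C f) :
    (Matrix.of fun i j : Fin n => D^[i] (f j)).det ≠ 0 := by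
  intro h0
  obtain ⟨h, hne, hh⟩ := Matrix.exists_mulVec_eq_zero_iff.2 h0
  refine hne (funext fun j => D.eq_zero_of_sum_mul_iterate_eq_zero hD f Finset.univ
    (by simpa using hf) h (fun i hi => ?_) j (Finset.mem_univ j))
  have := congrFun hh ⟨i, by simpa using hi⟩
  simpa [Matrix.mulVec, dotProduct, mul_comm] using this

/-- The ratios `D^i f / f` for an `f` with `D f = m f`. -/
def Derivation.logIterate {C H : Type*} [Field C] [Field H] [Algebra C H] (D : Derivation C H H)
    (m : H) : ℕ → H
  | 0 => 1
  | i + 1 => D (D.logIterate m i) + m * D.logIterate m i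

theorem Derivation.iterate_eq_logIterate_mul {C H : Type*} [Field C] [Field H] [Algebra C H]
    (D : Derivation C H H) {m f : H} (hf : D f = m * f) (i : ℕ) :
    D^[i] f = D.logIterate m i * f := by
  induction i with
  | zero => simp [Derivation.logIterate]
  | succ i ih =>
    rw [Function.iterate_succ_apply', ih, Derivation.leibniz, hf, Derivation.logIterate]
    simp only [smul_eq_mul]
    ring

/-! ### The operator `X d/dX` on Hahn series and the Wronskian bound. -/

namespace HahnSeries

variable {L : Type*} [Field L]

/-- A shortcut, so that constants do not act through power series. -/
instance constAlgebra : Algebra L (HahnSeries ℚ L) := HahnSeries.instAlgebra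

theorem algebraMap_eq_single (c : L) : algebraMap L (HahnSeries ℚ L) c = single 0 c := rfl

theorem addVal_single_one : addVal ℚ L (single (1 : ℚ) (1 : L)) = ((1 : ℚ) : WithTop ℚ) := by
  rw [addVal_apply, orderTop_single one_ne_zero]

theorem addVal_algebraMap {c : L} (hc : c ≠ 0) :
    addVal ℚ L (algebraMap L (HahnSeries ℚ L) c) = ((0 : ℚ) : WithTop ℚ) := by
  rw [algebraMap_eq_single, addVal_apply, orderTop_single hc]

theorem exists_addVal_eq {x : HahnSeries ℚ L} (hx : x ≠ 0) :
    ∃ a : ℚ, addVal ℚ L x = a := ⟨_, addVal_apply_of_ne hx⟩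

/-- The operator `X d/dX` on Hahn series with rational exponents, as a function. -/
def eulerFun (x : HahnSeries ℚ L) : HahnSeries ℚ L where
  coeff q := (q : L) * x.coeff q
  isPWO_support' := x.isPWO_support.mono fun q hq => by
    simp only [Function.mem_support, ne_eq, mul_eq_zero, not_or] at hq
    exact hq.2

theorem support_eulerFun_subset (x : HahnSeries ℚ L) : (eulerFun x).support ⊆ x.support :=
  fun q hq => by
    simp only [mem_support, eulerFun, ne_eq, mul_eq_zero, not_or] at hq
    exact hq.2

theorem coeff_eulerFun (x : HahnSeries ℚ L) (q : ℚ) :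
    (eulerFun x).coeff q = (q : L) * x.coeff q := rfl

variable [CharZero L]

theorem eulerFun_mul (x y : HahnSeries ℚ L) :
    eulerFun (x * y) = x * eulerFun y + y * eulerFun x := by
  ext q
  rw [mul_comm y, coeff_add, coeff_mul_left' x.isPWO_support (support_eulerFun_subset x),
    coeff_mul_right' y.isPWO_support (support_eulerFun_subset y)]
  simp only [coeff_eulerFun, coeff_mul, Finset.mul_sum, ← Finset.sum_add_distrib]
  refine Finset.sum_congr rfl fun ij hij => ?_
  rw [← (Finset.mem_antidiagonal.1 hij).2.2]
  push_cast
  ring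

/-- The derivation `X d/dX` on Hahn series with rational exponents. -/
def euler : Derivation L (HahnSeries ℚ L) (HahnSeries ℚ L) :=
  Derivation.mk'
    { toFun := eulerFun
      map_add' := fun _ _ => HahnSeries.ext (funext fun _ => mul_add _ _ _)
      map_smul' := fun _ _ => HahnSeries.ext (funext fun _ => mul_left_comm _ _ _) }
    eulerFun_mul

theorem coeff_euler (x : HahnSeries ℚ L) (q : ℚ) : (euler x).coeff q = q * x.coeff q := rfl

theorem addVal_le_addVal_euler (x : HahnSeries ℚ L) : addVal ℚ L x ≤ addVal ℚ L (euler x) := by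
  rw [addVal_apply, addVal_apply]
  rcases eq_or_ne (euler x) 0 with h | h
  · simp [h]
  rw [← order_eq_orderTop_of_ne_zero h]
  refine orderTop_le_of_coeff_ne_zero fun h0 => coeff_order_eq_zero.not.2 h ?_
  rw [coeff_euler, h0, mul_zero]

theorem addVal_le_addVal_euler_iterate (x : HahnSeries ℚ L) (i : ℕ) :
    addVal ℚ L x ≤ addVal ℚ L (euler^[i] x) := by
  induction i with
  | zero => rfl
  | succ i ih =>
    rw [Function.iterate_succ_apply']
    exact ih.trans (addVal_le_addVal_euler _)

theorem eq_algebraMap_of_euler_eq_zero (x : HahnSeries ℚ L) (hx : euler x = 0) :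
    ∃ c, algebraMap L (HahnSeries ℚ L) c = x := by
  refine ⟨x.coeff 0, ?_⟩
  rw [algebraMap_eq_single]
  ext q
  have h := congrArg (fun y => coeff y q) hx
  simp only [coeff_euler, coeff_zero, mul_eq_zero, Rat.cast_eq_zero] at h
  rcases eq_or_ne q 0 with rfl | hq
  · simp
  · rw [h.resolve_left hq, coeff_single_of_ne hq]

theorem euler_single_one : euler (single (1 : ℚ) (1 : L)) = single 1 1 := by
  ext q
  rw [coeff_euler]
  rcases eq_or_ne q 1 with rfl | hq
  · simp
  · rw [coeff_single_of_ne hq, mul_zero]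

/-- Cramer's rule for the Wronskian matrix, divided columnwise. -/
theorem addVal_sum_le_of_det_logIterate {n : ℕ} (f m : Fin n → HahnSeries ℚ L)
    (hf : LinearIndependent L f) (hm : ∀ j, euler (f j) = m j * f j) (c : Fin n → L) (j : Fin n)
    (hc : c j ≠ 0) :
    (Matrix.of fun i j : Fin n => euler.logIterate (m j) i).det ≠ 0 ∧
    addVal ℚ L (∑ k, c k • f k) ≤ addVal ℚ L (f j) + addVal ℚ L
      (Matrix.of fun i j : Fin n => euler.logIterate (m j) i).det := by
  classical
  set A := Matrix.of fun i j : Fin n => euler.logIterate (m j) i with hA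
  set F := ∑ k, c k • f k with hF
  have hf0 : ∀ k, f k ≠ 0 := hf.ne_zero
  have hF0 : F ≠ 0 := fun h0 => hc (Fintype.linearIndependent_iff.1 hf c h0 j)
  have hit : ∀ (i : Fin n) k, euler^[i] (f k) = A i k * f k := fun i k =>
    euler.iterate_eq_logIterate_mul (hm k) i
  set M := Matrix.of fun i k : Fin n => euler^[i] (f k) with hM
  have hMA : M.det = A.det * ∏ k, f k := by
    have : M = Matrix.of fun i k => f k * A i k := by
      ext1 i k
      simp [hM, hit, mul_comm]
    rw [this, Matrix.det_mul_row, mul_comm]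
  have hMne : M.det ≠ 0 := euler.det_iterate_ne_zero eq_algebraMap_of_euler_eq_zero f hf
  have hAne : A.det ≠ 0 := fun h => hMne (by rw [hMA, h, zero_mul])
  refine ⟨hAne, ?_⟩
  -- The family in which `F` takes the place of `f j`; the columns of Cramer's numerator are its
  -- iterated derivatives.
  set e : Fin n → HahnSeries ℚ L := Function.update f j F with he
  have he0 : ∀ k, e k ≠ 0 := fun k => by
    rcases eq_or_ne k j with rfl | hk
    · simpa [he] using hF0
    · simpa [he, hk] using hf0 k
  have hFit : ∀ i : ℕ, euler^[i] F = ∑ k, algebraMap L _ (c k) * euler^[i] (f k) := fun i => by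
    induction i with
    | zero => simp [hF, Algebra.smul_def]
    | succ i ih =>
      simp only [Function.iterate_succ_apply', ih, map_sum, ← Algebra.smul_def, Derivation.map_smul]
  have hcr : algebraMap L _ (c j) * M.det =
      (M.updateCol j fun i => euler^[i] F).det := by
    have h1 : (fun i : Fin n => euler^[i] F) = M.mulVec fun k => algebraMap L _ (c k) := by
      ext1 i
      simp [hFit, Matrix.mulVec, dotProduct, hM, mul_comm]
    rw [h1, ← Matrix.cramer_apply, Matrix.cramer_eq_adjugate_mulVec, Matrix.mulVec_mulVec,
      Matrix.adjugate_mul, Matrix.smul_mulVec, Matrix.one_mulVec]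
    simp [mul_comm]
  set E := Matrix.of fun i k : Fin n => euler^[i] (e k) / e k with hE
  have hcr2 : (M.updateCol j fun i => euler^[i] F).det = (∏ k, e k) * E.det := by
    rw [← Matrix.det_mul_row]
    congr 1
    ext1 i k
    simp only [hE, Matrix.of_apply, mul_div_cancel₀ _ (he0 k)]
    rcases eq_or_ne k j with rfl | hk
    · simp [he]
    · simp [he, hk, hM]
  -- Each entry `D^i e / e` has nonnegative valuation because `D` does not lower valuations.
  have hEv : 0 ≤ addVal ℚ L E.det := by
    have hmem : E.det ∈ (addVal ℚ L).toValuation.integer := by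
      rw [Matrix.det_apply]
      refine sum_mem fun σ _ => ?_
      rw [Units.smul_def]
      refine zsmul_mem (prod_mem fun i _ => ?_) _
      have h1 : 0 ≤ addVal ℚ L (E (σ i) i) := by
        obtain ⟨a, ha⟩ := exists_addVal_eq (he0 i)
        have h2 := addVal_le_addVal_euler_iterate (e i) (σ i)
        have h3 : E (σ i) i * e i = euler^[σ i] (e i) := div_mul_cancel₀ _ (he0 i)
        rw [← h3, AddValuation.map_mul, ha] at h2
        by_contra! hlt
        obtain ⟨b, hb⟩ := WithTop.ne_top_iff_exists.1 hlt.ne_top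
        rw [← hb] at h2 hlt
        norm_cast at h2 hlt
        linarith
      exact h1
    exact hmem
  have hpe : (∏ k, e k) * f j = (∏ k, f k) * F := by
    rw [he, Finset.prod_update_of_mem (Finset.mem_univ j), Finset.sdiff_singleton_eq_erase,
      ← Finset.mul_prod_erase _ f (Finset.mem_univ j)]
    ring
  have hpf : ∏ k, f k ≠ 0 := Finset.prod_ne_zero_iff.2 fun k _ => hf0 k
  have hfin : algebraMap L _ (c j) * A.det * f j = E.det * F := by
    apply mul_left_cancel₀ hpf
    calc _ = (algebraMap L _ (c j) * M.det) * f j := by rw [hMA]; ring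
      _ = (∏ k, e k) * f j * E.det := by rw [hcr, hcr2]; ring
      _ = _ := by rw [hpe]; ring
  have hval := congrArg (addVal ℚ L) hfin
  rw [AddValuation.map_mul, AddValuation.map_mul, AddValuation.map_mul, addVal_algebraMap hc,
    WithTop.coe_zero, zero_add] at hval
  rw [add_comm, hval]
  exact le_add_of_nonneg_left hEv

end HahnSeries

/-! ### Bidegrees and the degree of a resultant. -/

namespace Polynomial

/-- `P ∈ R[X][Y]` has degree at most `a` in `X` and at most `b` in `Y`. -/
def BidegreeLE {R : Type*} [CommRing R] (a b : ℕ) (P : R[X][Y]) : Prop :=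
  P.natDegree ≤ b ∧ ∀ j, (P.coeff j).natDegree ≤ a

namespace BidegreeLE

variable {R : Type*} [CommRing R] {a b a' b' : ℕ} {P Q : R[X][Y]}

theorem add (hP : BidegreeLE a b P) (hQ : BidegreeLE a b Q) : BidegreeLE a b (P + Q) :=
  ⟨natDegree_add_le_of_degree_le hP.1 hQ.1, fun j => by
    rw [coeff_add]
    exact natDegree_add_le_of_degree_le (hP.2 j) (hQ.2 j)⟩

theorem neg (hP : BidegreeLE a b P) : BidegreeLE a b (-P) :=
  ⟨by rw [natDegree_neg]; exact hP.1, fun j => by rw [coeff_neg, natDegree_neg]; exact hP.2 j⟩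

theorem sub (hP : BidegreeLE a b P) (hQ : BidegreeLE a b Q) : BidegreeLE a b (P - Q) := by
  rw [sub_eq_add_neg]
  exact hP.add hQ.neg

theorem mul (hP : BidegreeLE a b P) (hQ : BidegreeLE a' b' Q) :
    BidegreeLE (a + a') (b + b') (P * Q) :=
  ⟨natDegree_mul_le_of_le hP.1 hQ.1, fun j => by
    rw [coeff_mul]
    exact natDegree_sum_le_of_forall_le _ _ fun i _ => natDegree_mul_le_of_le (hP.2 _) (hQ.2 _)⟩

theorem CC (c : R) : BidegreeLE 0 0 (CC c) :=
  ⟨(natDegree_C _).le, fun j => by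
    rw [coeff_C]
    split_ifs <;> simp⟩

theorem eq_CC (h : BidegreeLE 0 0 P) : ∃ c, P = Polynomial.CC c := by
  obtain ⟨p, rfl⟩ := natDegree_eq_zero.1 (Nat.le_zero.1 h.1)
  have := h.2 0
  rw [coeff_C_zero] at this
  obtain ⟨c, rfl⟩ := natDegree_eq_zero.1 (Nat.le_zero.1 this)
  exact ⟨c, rfl⟩

end BidegreeLE

/-- The operator `X ∂/∂X` on bivariate polynomials. -/
def eulerX {R : Type*} [CommRing R] (P : R[X][Y]) : R[X][Y] :=
  ∑ i ∈ Finset.range (P.natDegree + 1), monomial i (X * derivative (P.coeff i))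

theorem coeff_eulerX {R : Type*} [CommRing R] (P : R[X][Y]) (i : ℕ) :
    (eulerX P).coeff i = X * derivative (P.coeff i) := by
  rw [eulerX, finsetSum_coeff]
  simp only [coeff_monomial, Finset.sum_ite_eq', Finset.mem_range]
  split_ifs with h
  · rfl
  · rw [coeff_eq_zero_of_natDegree_lt (by omega)]
    simp

theorem eulerX_add {R : Type*} [CommRing R] (P Q : R[X][Y]) :
    eulerX (P + Q) = eulerX P + eulerX Q := by
  ext1 i
  simp only [coeff_eulerX, coeff_add, derivative_add, mul_add]

theorem eulerX_monomial {R : Type*} [CommRing R] (n : ℕ) (p : R[X]) :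
    eulerX (monomial n p) = monomial n (X * derivative p) := by
  ext1 i
  simp only [coeff_eulerX, coeff_monomial]
  split_ifs <;> simp

theorem natDegree_X_mul_derivative_le {R : Type*} [CommRing R] (p : R[X]) :
    (X * derivative p).natDegree ≤ p.natDegree := by
  rcases Nat.eq_zero_or_pos p.natDegree with h | h
  · obtain ⟨c, rfl⟩ := natDegree_eq_zero.1 h
    simp
  · refine natDegree_mul_le.trans ?_
    have := natDegree_derivative_le p
    have := natDegree_X_le (R := R)
    omega

theorem BidegreeLE.eulerX {R : Type*} [CommRing R] {a b : ℕ} {P : R[X][Y]}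
    (h : BidegreeLE a b P) : BidegreeLE a b (eulerX P) :=
  ⟨natDegree_le_iff_coeff_eq_zero.2 fun i hi => by
    rw [coeff_eulerX, coeff_eq_zero_of_natDegree_lt (h.1.trans_lt hi)]
    simp, fun j => by
    rw [coeff_eulerX]
    exact (natDegree_X_mul_derivative_le _).trans (h.2 j)⟩

theorem BidegreeLE.Y_mul_derivative {R : Type*} [CommRing R] {a b : ℕ} {P : R[X][Y]}
    (h : BidegreeLE a b P) : BidegreeLE a b (Y * derivative P) :=
  ⟨(natDegree_X_mul_derivative_le _).trans h.1, fun j => by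
    cases j with
    | zero => simp
    | succ j =>
      rw [coeff_X_mul, coeff_derivative]
      refine natDegree_mul_le.trans ?_
      have h1 : ((j : R[X]) + 1).natDegree = 0 := by
        exact_mod_cast natDegree_natCast (R := R) (j + 1)
      rw [h1]
      exact h.2 _⟩

theorem natDegree_det_le {R : Type*} [CommRing R] {n : Type*} [Fintype n] [DecidableEq n]
    (M : Matrix n n R[X]) (b : n → ℕ) (h : ∀ i j, (M i j).natDegree ≤ b j) :
    M.det.natDegree ≤ ∑ j, b j := by
  rw [Matrix.det_apply]
  refine natDegree_sum_le_of_forall_le _ _ fun σ _ => ?_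
  rw [Units.smul_def]
  refine (natDegree_smul_le _ _).trans ((natDegree_prod_le _ _).trans ?_)
  exact Finset.sum_le_sum fun j _ => h _ j

/-- In the Sylvester matrix, `m` columns carry coefficients of `g` and `n` columns carry
coefficients of `f`. -/
theorem natDegree_resultant_le {R : Type*} [CommRing R] (f g : R[X][Y]) (m n a b : ℕ)
    (hf : ∀ j, (f.coeff j).natDegree ≤ a) (hg : ∀ j, (g.coeff j).natDegree ≤ b) :
    (resultant f g m n).natDegree ≤ m * b + n * a := by
  refine (natDegree_det_le _ (fun j => j.addCases (fun _ => b) fun _ => a) fun i j => ?_).trans ?_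
  · induction j using Fin.addCases with
    | left j =>
      simp only [sylvester, Matrix.of_apply, Fin.addCases_left]
      split_ifs
      · exact hg _
      · simp
    | right j =>
      simp only [sylvester, Matrix.of_apply, Fin.addCases_right]
      split_ifs
      · exact hf _
      · simp
  · rw [Fin.sum_univ_add]
    simp

end Polynomial

/-! ### Evaluation at `(X, φ)` and the resultant bound. -/

namespace HahnSeries

variable {L : Type*} [Field L]

/-- Evaluation of a bivariate polynomial at `(X, φ)`. -/
def evalAt (φ : HahnSeries ℚ L) : L[X][Y] →ₐ[L] HahnSeries ℚ L :=
  aevalAeval (single (1 : ℚ) (1 : L)) φ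

theorem evalAt_C (φ : HahnSeries ℚ L) (p : L[X]) :
    evalAt φ (Polynomial.C p) = aeval (single (1 : ℚ) (1 : L)) p :=
  aevalAeval_C _ _ _

theorem evalAt_Y (φ : HahnSeries ℚ L) : evalAt φ Y = φ :=
  aevalAeval_Y _ _

theorem evalAt_monomial (φ : HahnSeries ℚ L) (n : ℕ) (p : L[X]) :
    evalAt φ (monomial n p) = aeval (single (1 : ℚ) (1 : L)) p * φ ^ n := by
  rw [← C_mul_X_pow_eq_monomial, map_mul, map_pow, evalAt_C, evalAt_Y]

theorem evalAt_CC (φ : HahnSeries ℚ L) (c : L) :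
    evalAt φ (CC c) = algebraMap L _ c := by
  rw [← coe_algebraMap_eq_CC, AlgHom.commutes]

theorem evalAt_eq_sum (φ : HahnSeries ℚ L) (P : L[X][Y]) :
    evalAt φ P = ∑ i ∈ Finset.range (P.natDegree + 1),
      aeval (single (1 : ℚ) (1 : L)) (P.coeff i) * φ ^ i := by
  conv_lhs => rw [P.as_sum_range' _ (Nat.lt_succ_self _)]
  simp only [map_sum, evalAt_monomial]

theorem coeff_aeval_single_one (p : L[X]) (n : ℕ) :
    (aeval (single (1 : ℚ) (1 : L)) p).coeff (n : ℚ) = p.coeff n := by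
  rw [aeval_eq_sum_range, coeff_sum]
  simp only [single_pow, one_pow, coeff_smul, smul_eq_mul, nsmul_eq_mul, mul_one, coeff_single,
    Nat.cast_inj, mul_ite, mul_zero, Finset.sum_ite_eq, Finset.mem_range]
  split_ifs with h
  · rfl
  · rw [Polynomial.coeff_eq_zero_of_natDegree_lt (by omega)]

theorem aeval_single_one_injective :
    Function.Injective (aeval (single (1 : ℚ) (1 : L)) : L[X] → HahnSeries ℚ L) := fun p q h => by
  ext n
  rw [← coeff_aeval_single_one, h, coeff_aeval_single_one]

theorem addVal_aeval_le {p : L[X]} (hp : p ≠ 0) :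
    addVal ℚ L (aeval (single (1 : ℚ) (1 : L)) p) ≤ ((p.natDegree : ℚ) : WithTop ℚ) := by
  apply addVal_le_of_coeff_ne_zero
  rw [coeff_aeval_single_one]
  simpa using hp

theorem addVal_pow_eq {φ : HahnSeries ℚ L} {v : ℚ} (hv : addVal ℚ L φ = v) (n : ℕ) :
    addVal ℚ L (φ ^ n) = ((n * v : ℚ) : WithTop ℚ) := by
  rw [AddValuation.map_pow, hv, ← WithTop.coe_nsmul, nsmul_eq_mul]

theorem addVal_aeval_nonneg (p : L[X]) :
    ((0 : ℚ) : WithTop ℚ) ≤ addVal ℚ L (aeval (single (1 : ℚ) (1 : L)) p) := by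
  rw [aeval_eq_sum_range]
  refine AddValuation.map_le_sum _ fun i _ => ?_
  rcases eq_or_ne (p.coeff i) 0 with h | h
  · simp [h]
  rw [Algebra.smul_def, AddValuation.map_mul, addVal_algebraMap h, addVal_pow_eq addVal_single_one,
    ← WithTop.coe_add, WithTop.coe_le_coe]
  positivity

theorem le_addVal_evalAt {φ : HahnSeries ℚ L} {v : ℚ} (hv : addVal ℚ L φ = v) {b : ℕ}
    {P : L[X][Y]} (hP : P.natDegree ≤ b) :
    ((b * min 0 v : ℚ) : WithTop ℚ) ≤ addVal ℚ L (evalAt φ P) := by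
  rw [evalAt_eq_sum]
  refine AddValuation.map_le_sum _ fun i hi => ?_
  rw [AddValuation.map_mul, addVal_pow_eq hv]
  have h1 : (b * min 0 v : ℚ) ≤ i * v := by
    have hib : (i : ℚ) ≤ b := by
      rw [Finset.mem_range] at hi
      exact_mod_cast (by omega : i ≤ b)
    have h0 : (0 : ℚ) ≤ i := by positivity
    nlinarith [min_le_left 0 v, min_le_right 0 v]
  calc ((b * min 0 v : ℚ) : WithTop ℚ) ≤ ((i * v : ℚ) : WithTop ℚ) := WithTop.coe_le_coe.2 h1
    _ = ((0 : ℚ) : WithTop ℚ) + ((i * v : ℚ) : WithTop ℚ) := by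
      rw [WithTop.coe_zero, zero_add]
    _ ≤ _ := add_le_add_left (addVal_aeval_nonneg _) _

/-- The embedding of the field of rational functions into the Hahn series. -/
def ofFrac : FractionRing L[X] →+* HahnSeries ℚ L :=
  IsFractionRing.lift (A := L[X]) (g := (aeval (single (1 : ℚ) (1 : L))).toRingHom)
    (aeval_single_one_injective (L := L))

theorem ofFrac_algebraMap (p : L[X]) :
    ofFrac (algebraMap L[X] (FractionRing L[X]) p) = aeval (single (1 : ℚ) (1 : L)) p := by
  unfold ofFrac
  rw [IsFractionRing.lift_algebraMap]
  rfl

theorem eval₂_ofFrac_map (φ : HahnSeries ℚ L) (P : L[X][Y]) :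
    (P.map (algebraMap L[X] (FractionRing L[X]))).eval₂ ofFrac φ = evalAt φ P := by
  rw [evalAt_eq_sum, eval₂_map, eval₂_eq_sum_range]
  simp only [RingHom.comp_apply, ofFrac_algebraMap]

theorem evalAt_eq_zero_of_map_dvd {g P : L[X][Y]} {φ : HahnSeries ℚ L} (hφ : evalAt φ g = 0)
    (h : g.map (algebraMap L[X] (FractionRing L[X])) ∣
      P.map (algebraMap L[X] (FractionRing L[X]))) : evalAt φ P = 0 := by
  obtain ⟨Q, hQ⟩ := h
  rw [← eval₂_ofFrac_map, hQ, eval₂_mul, eval₂_ofFrac_map, hφ, zero_mul]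

/-- Gauss's lemma. Over the field `L(X)`, irreducibility gives the alternative "coprime or divides"
used below. -/
theorem irreducible_map_frac {g : L[X][Y]} (hg : Irreducible g) (hg0 : g.natDegree ≠ 0) :
    Irreducible (g.map (algebraMap L[X] (FractionRing L[X]))) :=
  ((hg.isPrimitive hg0).irreducible_iff_irreducible_map_fraction_map).1 hg

theorem map_dvd_of_evalAt_eq_zero {g P : L[X][Y]} {φ : HahnSeries ℚ L} (hg : Irreducible g)
    (hg0 : g.natDegree ≠ 0) (hφ : evalAt φ g = 0) (hP : evalAt φ P = 0) :
    g.map (algebraMap L[X] (FractionRing L[X])) ∣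
      P.map (algebraMap L[X] (FractionRing L[X])) := by
  refine ((irreducible_map_frac hg hg0).isCoprime_or_dvd _).resolve_left ?_
  rintro ⟨a, b, hab⟩
  have := congrArg (eval₂ ofFrac φ) hab
  rw [eval₂_add, eval₂_mul, eval₂_mul, eval₂_ofFrac_map, eval₂_ofFrac_map, hφ, hP, eval₂_one,
    mul_zero, mul_zero, add_zero] at this
  exact zero_ne_one this

theorem resultant_ne_zero_of_irreducible {g P : L[X][Y]} {φ : HahnSeries ℚ L} (hg : Irreducible g)
    (hg0 : g.natDegree ≠ 0) (hφ : evalAt φ g = 0) (hP : evalAt φ P ≠ 0) :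
    resultant P g ≠ 0 := fun h => by
  have hinj := IsFractionRing.injective L[X] (FractionRing L[X])
  have h1 := ((irreducible_map_frac hg hg0).isCoprime_or_dvd _).resolve_right
    fun h => hP (evalAt_eq_zero_of_map_dvd hφ h)
  have h2 := resultant_map_map P g P.natDegree g.natDegree (algebraMap L[X] (FractionRing L[X]))
  rw [h, map_zero] at h2
  have h3 : resultant (P.map (algebraMap L[X] (FractionRing L[X])))
      (g.map (algebraMap L[X] (FractionRing L[X]))) = 0 := by
    rwa [natDegree_map_eq_of_injective hinj, natDegree_map_eq_of_injective hinj]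
  exact (resultant_eq_zero_iff.1 h3).2 h1.symm

theorem evalAt_derivative_ne_zero [CharZero L] {g : L[X][Y]} {φ : HahnSeries ℚ L}
    (hg : Irreducible g) (hg0 : g.natDegree ≠ 0) (hφ : evalAt φ g = 0) :
    evalAt φ (derivative g) ≠ 0 := fun h => by
  have hinj := IsFractionRing.injective L[X] (FractionRing L[X])
  have h0 : derivative g ≠ 0 := fun h => hg0 (derivative_eq_zero.1 h)
  have h1 := natDegree_le_of_dvd (map_dvd_of_evalAt_eq_zero hg hg0 hφ h)
    ((Polynomial.map_ne_zero_iff hinj).2 h0)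
  rw [natDegree_map_eq_of_injective hinj, natDegree_map_eq_of_injective hinj] at h1
  exact absurd (natDegree_derivative_lt hg0) (by omega)

/-- The resultant is a nonzero polynomial in `X` alone, so its valuation is at most its degree,
hence at most `2 k dX dY`. At `φ` it equals `p(X, φ) P(X, φ)` with `deg_Y p ≤ dY - 1`, and `p(X, φ)`
has valuation at least `(dY - 1) min 0 v`. -/
theorem addVal_evalAt_le {g P : L[X][Y]} {φ : HahnSeries ℚ L} (hg : Irreducible g)
    (hφ : evalAt φ g = 0) (hP : evalAt φ P ≠ 0) {v : ℚ} (hv : addVal ℚ L φ = v) {dX dY k : ℕ}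
    (hgd : BidegreeLE dX dY g) (hdY : 1 ≤ g.natDegree) (hPd : BidegreeLE (k * dX) (k * dY) P) :
    addVal ℚ L (evalAt φ P) ≤
      ((2 * k * dX * dY - (dY - 1) * min 0 v : ℚ) : WithTop ℚ) := by
  have hR := resultant_ne_zero_of_irreducible hg (by omega) hφ hP
  obtain ⟨p, q, hp, -, hpq⟩ := exists_mul_add_mul_eq_C_resultant (m := P.natDegree)
    (n := g.natDegree) P g le_rfl le_rfl (Or.inr (by omega))
  have hev := congrArg (evalAt φ) hpq
  rw [map_add, map_mul, map_mul, hφ, zero_mul, add_zero, evalAt_C] at hev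
  have h1 := addVal_aeval_le hR
  have hdeg := natDegree_resultant_le P g P.natDegree g.natDegree _ _ hPd.2 hgd.2
  have hp1 : p.natDegree ≤ dY - 1 := by
    rcases eq_or_ne p 0 with rfl | hp0
    · simp
    · have := (natDegree_lt_iff_degree_lt hp0).2 hp
      have := hgd.1
      omega
  have h2 := le_addVal_evalAt hv hp1
  obtain ⟨a, ha⟩ := exists_addVal_eq hP
  rw [← hev, AddValuation.map_mul, ha] at h1
  rw [ha]
  have hdY1 : 1 ≤ dY := hdY.trans hgd.1
  obtain ⟨b, hb⟩ := exists_addVal_eq (x := evalAt φ p) (fun h0 => hR (by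
    rw [h0, mul_zero] at hev
    exact aeval_single_one_injective (by rw [← hev, map_zero])))
  rw [hb] at h1 h2
  norm_cast at h1 h2 ⊢
  push_cast [hdY1] at h1 h2 ⊢
  have h3 : ((P.resultant g).natDegree : ℚ) ≤ 2 * k * dX * dY := by
    have h4 : P.natDegree * dX ≤ k * dY * dX := Nat.mul_le_mul_right _ hPd.1
    have h5 : g.natDegree * (k * dX) ≤ dY * (k * dX) := Nat.mul_le_mul_right _ hgd.1
    have h6 : (P.resultant g).natDegree ≤ 2 * k * dX * dY := by
      refine hdeg.trans ((add_le_add h4 h5).trans (le_of_eq ?_))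
      ring
    exact_mod_cast h6
  linarith

end HahnSeries

/-! ### Size of `v`, and fractions in `X` and `φ` with controlled numerators. -/

namespace HahnSeries

variable {L : Type*} [Field L]

theorem evalAt_ne_zero_of_dominant {φ : HahnSeries ℚ L} {v : ℚ} (hv : addVal ℚ L φ = v)
    {g : L[X][Y]} {dX : ℕ} (hg : ∀ j, (g.coeff j).natDegree ≤ dX) {k : ℕ} (hk : g.coeff k ≠ 0)
    (h : ∀ j, j ≠ k → g.coeff j ≠ 0 → dX + k * v < j * v) : evalAt φ g ≠ 0 := by
  have hkmem : k ∈ Finset.range (g.natDegree + 1) :=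
    Finset.mem_range.2 (Nat.lt_succ_of_le (le_natDegree_of_ne_zero hk))
  have h1 : addVal ℚ L (aeval (single (1 : ℚ) (1 : L)) (g.coeff k) * φ ^ k) ≤
      ((dX + k * v : ℚ) : WithTop ℚ) := by
    rw [AddValuation.map_mul, addVal_pow_eq hv, WithTop.coe_add]
    refine add_le_add_left ((addVal_aeval_le hk).trans (WithTop.coe_le_coe.2 ?_)) _
    exact_mod_cast hg k
  have h2 : ((dX + k * v : ℚ) : WithTop ℚ) < addVal ℚ L
      (∑ j ∈ (Finset.range (g.natDegree + 1)).erase k,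
        aeval (single (1 : ℚ) (1 : L)) (g.coeff j) * φ ^ j) := by
    refine AddValuation.map_lt_sum _ WithTop.coe_ne_top fun j hj => ?_
    rcases eq_or_ne (g.coeff j) 0 with h0 | h0
    · rw [h0, map_zero, zero_mul, AddValuation.map_zero]
      exact WithTop.coe_lt_top _
    · refine (WithTop.coe_lt_coe.2 (h j (Finset.ne_of_mem_erase hj) h0)).trans_le ?_
      rw [AddValuation.map_mul, addVal_pow_eq hv]
      have := add_le_add_left (addVal_aeval_nonneg (g.coeff j)) ((j * v : ℚ) : WithTop ℚ)
      rwa [WithTop.coe_zero, zero_add] at this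
  intro h0
  rw [evalAt_eq_sum, ← Finset.add_sum_erase _ _ hkmem] at h0
  have h3 := AddValuation.map_add_eq_of_lt_left _ (h1.trans_lt h2)
  rw [h0, AddValuation.map_zero] at h3
  rw [← h3] at h1
  exact WithTop.coe_ne_top (top_le_iff.1 h1)

/-- Coefficients have valuation between 0 and `dX`. If `v > dX`, the term of lowest degree in `Y`
has strictly smallest valuation; if `v < -dX`, the term of highest degree does. Nothing can then
cancel it. -/
theorem abs_le_of_evalAt_eq_zero {φ : HahnSeries ℚ L} {v : ℚ} (hv : addVal ℚ L φ = v)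
    {g : L[X][Y]} {dX : ℕ} (hg : ∀ j, (g.coeff j).natDegree ≤ dX) (hg0 : g ≠ 0)
    (h : evalAt φ g = 0) : |v| ≤ dX := by
  by_contra! hlt
  rcases lt_abs.1 hlt with hlt | hlt
  · refine evalAt_ne_zero_of_dominant hv hg (k := g.natTrailingDegree)
      (by simpa using hg0) (fun j hj hj0 => ?_) h
    have h1 : g.natTrailingDegree + 1 ≤ j :=
      lt_of_le_of_ne (natTrailingDegree_le_of_ne_zero hj0) hj.symm
    have h2 : (g.natTrailingDegree : ℚ) + 1 ≤ j := by exact_mod_cast h1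
    have : (0 : ℚ) ≤ dX := by positivity
    nlinarith
  · refine evalAt_ne_zero_of_dominant hv hg (k := g.natDegree)
      (by simpa using hg0) (fun j hj hj0 => ?_) h
    have h1 : j + 1 ≤ g.natDegree := lt_of_le_of_ne (le_natDegree_of_ne_zero hj0) hj
    have h2 : (j : ℚ) + 1 ≤ g.natDegree := by exact_mod_cast h1
    have : (0 : ℚ) ≤ dX := by positivity
    nlinarith

/-- `a` is a fraction with denominator `q(X, φ) ^ k` and numerator of bidegree at most
`k (dX, dY)` in `(X, φ)`. -/
def HasNumerator (φ : HahnSeries ℚ L) (q : L[X][Y]) (dX dY k : ℕ) (a : HahnSeries ℚ L) : Prop :=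
  ∃ P, BidegreeLE (k * dX) (k * dY) P ∧ evalAt φ P = a * evalAt φ q ^ k

namespace HasNumerator

variable {φ : HahnSeries ℚ L} {q : L[X][Y]} {dX dY k l : ℕ} {a b : HahnSeries ℚ L}

theorem add (ha : HasNumerator φ q dX dY k a) (hb : HasNumerator φ q dX dY k b) :
    HasNumerator φ q dX dY k (a + b) := by
  obtain ⟨P, hP, hPa⟩ := ha
  obtain ⟨Q, hQ, hQb⟩ := hb
  exact ⟨P + Q, hP.add hQ, by rw [map_add, hPa, hQb, add_mul]⟩

theorem mul (ha : HasNumerator φ q dX dY k a) (hb : HasNumerator φ q dX dY l b) :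
    HasNumerator φ q dX dY (k + l) (a * b) := by
  obtain ⟨P, hP, hPa⟩ := ha
  obtain ⟨Q, hQ, hQb⟩ := hb
  refine ⟨P * Q, ?_, by rw [map_mul, hPa, hQb]; ring⟩
  rw [add_mul, add_mul]
  exact hP.mul hQ

theorem algebraMap (c : L) : HasNumerator φ q dX dY 0 (algebraMap L _ c) :=
  ⟨CC c, by simpa using BidegreeLE.CC c, by rw [evalAt_CC]; simp⟩

theorem succ (hq : BidegreeLE dX dY q) (ha : HasNumerator φ q dX dY k a) :
    HasNumerator φ q dX dY (k + 1) a := by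
  obtain ⟨P, hP, hPa⟩ := ha
  refine ⟨P * q, ?_, by rw [map_mul, hPa]; ring⟩
  rw [add_mul, add_mul, one_mul, one_mul]
  exact hP.mul hq

theorem zero : HasNumerator φ q dX dY k 0 :=
  ⟨0, ⟨by simp, fun j => by simp⟩, by simp⟩

theorem sum {ι : Type*} (s : Finset ι) (f : ι → HahnSeries ℚ L)
    (h : ∀ i ∈ s, HasNumerator φ q dX dY k (f i)) : HasNumerator φ q dX dY k (∑ i ∈ s, f i) :=
  Finset.sum_induction f _ (fun _ _ => add) zero h

theorem prod {ι : Type*} (s : Finset ι) (f : ι → HahnSeries ℚ L) (e : ι → ℕ)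
    (h : ∀ i ∈ s, HasNumerator φ q dX dY (e i) (f i)) :
    HasNumerator φ q dX dY (∑ i ∈ s, e i) (∏ i ∈ s, f i) := by
  classical
  induction s using Finset.induction_on with
  | empty => simpa using algebraMap (φ := φ) (q := q) (dX := dX) (dY := dY) (1 : L)
  | insert i s hi ih =>
    rw [Finset.sum_insert hi, Finset.prod_insert hi]
    exact (h i (Finset.mem_insert_self i s)).mul
      (ih fun j hj => h j (Finset.mem_insert_of_mem hj))

theorem det {n : ℕ} (A : Matrix (Fin n) (Fin n) (HahnSeries ℚ L)) (e : Fin n → ℕ)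
    (h : ∀ i j, HasNumerator φ q dX dY (e i) (A i j)) :
    HasNumerator φ q dX dY (∑ i, e i) A.det := by
  rw [Matrix.det_apply']
  refine sum _ _ fun σ _ => ?_
  have h1 := prod Finset.univ (fun i => A (σ i) i) (fun i => e (σ i)) fun i _ => h (σ i) i
  rw [Equiv.sum_comp σ e] at h1
  have h2 := (algebraMap (φ := φ) (q := q) (dX := dX) (dY := dY)
    (((Equiv.Perm.sign σ : ℤ) : L))).mul h1
  rwa [zero_add, map_intCast] at h2

end HasNumerator

/-- The constant in the valuation bound over the field of constants. -/
def gapConstant (dX dY : ℕ) (v : ℚ) : ℚ := 2 * dX * dY - (2 * dY - 1) * min 0 v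

theorem addVal_le_of_hasNumerator {g : L[X][Y]} {φ : HahnSeries ℚ L} (hg : Irreducible g)
    (hφ : evalAt φ g = 0) {v : ℚ} (hv : addVal ℚ L φ = v) {dX dY k : ℕ}
    (hgd : BidegreeLE dX dY g) (hdY : 1 ≤ g.natDegree) {q : L[X][Y]} (hq : BidegreeLE dX dY q)
    (hq0 : evalAt φ q ≠ 0) {a : HahnSeries ℚ L} (ha0 : a ≠ 0)
    (ha : HasNumerator φ q dX dY k a) :
    addVal ℚ L a ≤ ((gapConstant dX dY v * k : ℚ) : WithTop ℚ) := by
  obtain ⟨P, hP, hPa⟩ := ha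
  have hP0 : evalAt φ P ≠ 0 := by
    rw [hPa]
    exact mul_ne_zero ha0 (pow_ne_zero _ hq0)
  -- The resultant bound contains `-(dY - 1) min 0 v`, which does not scale with `k`. It is absorbed
  -- when `k ≥ 1`; for `k = 0` the numerator is a constant.
  rcases Nat.eq_zero_or_pos k with rfl | hk
  · rw [zero_mul, zero_mul] at hP
    obtain ⟨c, rfl⟩ := hP.eq_CC
    rw [evalAt_CC] at hPa hP0
    rw [pow_zero, mul_one] at hPa
    rw [← hPa, addVal_algebraMap fun h => hP0 (by rw [h, map_zero])]
    simp
  · have h1 := addVal_evalAt_le hg hφ hP0 hv hgd hdY hP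
    have h2 := le_addVal_evalAt hv hq.1
    obtain ⟨b, hb⟩ := exists_addVal_eq hq0
    obtain ⟨c, hc⟩ := exists_addVal_eq ha0
    rw [hPa, AddValuation.map_mul, addVal_pow_eq hb, hc] at h1
    rw [hb] at h2
    rw [hc]
    rw [← WithTop.coe_add, WithTop.coe_le_coe] at h1
    rw [WithTop.coe_le_coe] at h2 ⊢
    rw [gapConstant]
    have h3 : (1 : ℚ) ≤ k := by exact_mod_cast hk
    have h4 : (1 : ℚ) ≤ dY := by exact_mod_cast hdY.trans hgd.1
    have h5 := min_le_left 0 v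
    nlinarith [mul_le_mul_of_nonneg_left h2 (by linarith : (0 : ℚ) ≤ k),
      mul_nonneg (mul_nonneg (sub_nonneg.2 h3) (sub_nonneg.2 h4)) (neg_nonneg.2 h5)]

variable [CharZero L]

theorem euler_aeval (p : L[X]) :
    euler (aeval (single (1 : ℚ) (1 : L)) p) =
      aeval (single (1 : ℚ) (1 : L)) (X * derivative p) := by
  rw [Derivation.map_aeval, euler_single_one, map_mul, aeval_X, smul_eq_mul, mul_comm]

theorem euler_evalAt (φ : HahnSeries ℚ L) (P : L[X][Y]) :
    euler (evalAt φ P) = evalAt φ (eulerX P) + evalAt φ (derivative P) * euler φ := by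
  induction P using Polynomial.induction_on' with
  | add P Q hP hQ => rw [map_add, map_add, hP, hQ, eulerX_add, derivative_add, map_add, map_add]; ring
  | monomial n p =>
    rw [eulerX_monomial, derivative_monomial, evalAt_monomial, evalAt_monomial, evalAt_monomial,
      Derivation.leibniz, Derivation.leibniz_pow, euler_aeval, map_mul, map_mul, map_natCast]
    simp only [smul_eq_mul, nsmul_eq_mul]
    ring

/-- Chain rule with `Dφ = (p/q) φ`. Since `X ∂/∂X` and `Y ∂/∂Y` preserve bidegrees, only one factor
`q` or `p` is added. -/
theorem exists_evalAt_eq_mul_euler {φ : HahnSeries ℚ L} {p q : L[X][Y]} {dX dY : ℕ}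
    (hp : BidegreeLE dX dY p) (hq : BidegreeLE dX dY q)
    (hpq : evalAt φ q * euler φ = evalAt φ p * φ) {a b : ℕ} {P : L[X][Y]} (hP : BidegreeLE a b P) :
    ∃ Q, BidegreeLE (dX + a) (dY + b) Q ∧ evalAt φ Q = evalAt φ q * euler (evalAt φ P) := by
  refine ⟨q * eulerX P + p * (Y * derivative P),
    (hq.mul hP.eulerX).add (hp.mul hP.Y_mul_derivative), ?_⟩
  rw [euler_evalAt, map_add, map_mul, map_mul, map_mul, evalAt_Y]
  linear_combination (- evalAt φ (derivative P)) * hpq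

/-- Quotient rule for `P / q^k`, multiplied through by `q^(k+2)`: one extra `q` is the denominator
of `D`, the other comes from differentiating `q`. -/
theorem HasNumerator.euler {φ : HahnSeries ℚ L} {p q : L[X][Y]} {dX dY k : ℕ}
    (hp : BidegreeLE dX dY p) (hq : BidegreeLE dX dY q)
    (hpq : evalAt φ q * euler φ = evalAt φ p * φ) {a : HahnSeries ℚ L}
    (ha : HasNumerator φ q dX dY k a) : HasNumerator φ q dX dY (k + 2) (euler a) := by
  obtain ⟨P, hP, hPa⟩ := ha
  obtain ⟨P', hP', hPP'⟩ := exists_evalAt_eq_mul_euler hp hq hpq hP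
  obtain ⟨q', hq', hqq'⟩ := exists_evalAt_eq_mul_euler hp hq hpq hq
  refine ⟨q * P' - CC (k : L) * (P * q'), ?_, ?_⟩
  · have h1 := hq.mul hP'
    have h2 := (BidegreeLE.CC (k : L)).mul (hP.mul hq')
    rw [show dX + (dX + k * dX) = (k + 2) * dX by ring,
      show dY + (dY + k * dY) = (k + 2) * dY by ring] at h1
    rw [show 0 + (k * dX + (dX + dX)) = (k + 2) * dX by ring,
      show 0 + (k * dY + (dY + dY)) = (k + 2) * dY by ring] at h2
    exact h1.sub h2
  · rw [map_sub, map_mul, map_mul, map_mul, evalAt_CC, hPP', hqq', hPa, Derivation.leibniz,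
      Derivation.leibniz_pow, map_natCast]
    simp only [smul_eq_mul, nsmul_eq_mul]
    cases k with
    | zero => simp; ring
    | succ k =>
      rw [Nat.add_sub_cancel]
      push_cast
      ring

/-- Each step `a ↦ D a + m a` costs two powers of `q`, except the first, which costs one because `D
1 = 0`. At `i = 0` the truncated `2 * i - 1` is 0, as it should be. -/
theorem HasNumerator.logIterate {φ : HahnSeries ℚ L} {p q : L[X][Y]} {dX dY : ℕ}
    (hp : BidegreeLE dX dY p) (hq : BidegreeLE dX dY q)
    (hpq : evalAt φ q * HahnSeries.euler φ = evalAt φ p * φ) {m : HahnSeries ℚ L}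
    (hm : HasNumerator φ q dX dY 1 m) (i : ℕ) :
    HasNumerator φ q dX dY (2 * i - 1) (HahnSeries.euler.logIterate m i) := by
  induction i with
  | zero => simpa [Derivation.logIterate] using
      HasNumerator.algebraMap (φ := φ) (q := q) (dX := dX) (dY := dY) (1 : L)
  | succ i ih =>
    rw [Derivation.logIterate]
    cases i with
    | zero => simpa [Derivation.logIterate] using hm
    | succ i =>
      have h1 := ih.euler hp hq hpq
      have h2 := (hm.mul ih).succ hq
      rw [show 2 * (i + 1) - 1 + 2 = 2 * (i + 1 + 1) - 1 by omega] at h1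
      rw [show 1 + (2 * (i + 1) - 1) + 1 = 2 * (i + 1 + 1) - 1 by omega] at h2
      exact h1.add h2

theorem sum_fin_two_mul_sub_one (n : ℕ) : ∑ i : Fin n, (2 * (i : ℕ) - 1) = (n - 1) ^ 2 := by
  rw [Fin.sum_univ_eq_sum_range fun i => 2 * i - 1]
  induction n with
  | zero => rfl
  | succ n ih =>
    rw [Finset.sum_range_succ, ih]
    cases n with
    | zero => rfl
    | succ n =>
      rw [Nat.add_sub_cancel, Nat.add_sub_cancel, show 2 * (n + 1) - 1 = 2 * n + 1 by omega]
      ring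

/-- The valuation bound for families which are linearly independent over the field of constants. -/
theorem addVal_sum_le {g : L[X][Y]} {φ : HahnSeries ℚ L} (hg : Irreducible g)
    (hφ : evalAt φ g = 0) {v : ℚ} (hv : addVal ℚ L φ = v) {dX dY : ℕ}
    (hgd : BidegreeLE dX dY g) (hdY : 1 ≤ g.natDegree) {n : ℕ} (α β : Fin n → ℕ)
    (hf : LinearIndependent L fun j => single (1 : ℚ) (1 : L) ^ α j * φ ^ β j)
    (c : Fin n → L) (j : Fin n) (hc : c j ≠ 0) :
    addVal ℚ L (∑ k, c k • (single (1 : ℚ) (1 : L) ^ α k * φ ^ β k)) ≤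
      ((α j + v * β j + gapConstant dX dY v * ((n : ℚ) - 1) ^ 2 : ℚ) : WithTop ℚ) := by
  have hφ0 : φ ≠ 0 := by
    rintro rfl
    rw [AddValuation.map_zero] at hv
    exact WithTop.coe_ne_top hv.symm
  set x := single (1 : ℚ) (1 : L) with hx
  -- Applying `D` to `g(X, φ) = 0` gives `Dφ/φ = p/q`. The factor `Y` in `q` makes this a
  -- logarithmic derivative while keeping the bidegree within `(dX, dY)`.
  set q := Y * derivative g with hq
  set p := -eulerX g with hp
  have hqd : BidegreeLE dX dY q := hgd.Y_mul_derivative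
  have hpd : BidegreeLE dX dY p := hgd.eulerX.neg
  have hq0 : evalAt φ q ≠ 0 := by
    rw [hq, map_mul, evalAt_Y]
    exact mul_ne_zero hφ0 (evalAt_derivative_ne_zero hg (by omega) hφ)
  have hpq : evalAt φ q * euler φ = evalAt φ p * φ := by
    have h1 := euler_evalAt φ g
    rw [hφ, map_zero] at h1
    rw [hq, hp, map_mul, map_neg, evalAt_Y]
    linear_combination (-φ) * h1
  set m : Fin n → HahnSeries ℚ L := fun j =>
    algebraMap L _ (α j : L) + algebraMap L _ (β j : L) * (euler φ / φ) with hm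
  have hmf : ∀ j, euler (x ^ α j * φ ^ β j) = m j * (x ^ α j * φ ^ β j) := fun j => by
    have hpow : ∀ (y : HahnSeries ℚ L) (r : HahnSeries ℚ L), euler y = r * y → ∀ k : ℕ,
        euler (y ^ k) = (k : HahnSeries ℚ L) * r * y ^ k := fun y r hr k => by
      rw [Derivation.leibniz_pow, hr]
      simp only [smul_eq_mul, nsmul_eq_mul]
      cases k with
      | zero => simp
      | succ k => rw [Nat.add_sub_cancel]; ring
    rw [Derivation.leibniz, hpow x 1 (by rw [hx, euler_single_one, one_mul]),
      hpow φ (euler φ / φ) (div_mul_cancel₀ _ hφ0).symm]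
    simp only [hm, smul_eq_mul, map_natCast]
    ring
  have hmn : ∀ j, HasNumerator φ q dX dY 1 (m j) := fun j => by
    refine (HasNumerator.algebraMap _).succ hqd |>.add ?_
    have hu : HasNumerator φ q dX dY 1 (euler φ / φ) := by
      refine ⟨p, by simpa using hpd, ?_⟩
      field_simp
      linear_combination -hpq
    simpa using (HasNumerator.algebraMap (β j : L)).mul hu
  obtain ⟨h1, h2⟩ := addVal_sum_le_of_det_logIterate _ m hf hmf c j hc
  refine h2.trans ?_
  have h3 := addVal_le_of_hasNumerator hg hφ hv hgd hdY hqd hq0 h1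
    (HasNumerator.det _ (fun i : Fin n => 2 * (i : ℕ) - 1)
      fun i j => (hmn j).logIterate hpd hqd hpq i)
  have hn : 1 ≤ n := j.pos
  rw [sum_fin_two_mul_sub_one] at h3
  push_cast [hn] at h3
  rw [AddValuation.map_mul, addVal_pow_eq addVal_single_one, addVal_pow_eq hv, WithTop.coe_add]
  refine add_le_add (le_of_eq ?_) h3
  rw [← WithTop.coe_add]
  congr 1
  ring

end HahnSeries

/-! ### From independent families to nonvanishing partial sums. -/

/-- Indices are eliminated one at a time along linear relations, dropping any whose coefficient
becomes zero. -/
theorem exists_linearIndepOn_sum_eq {L M ι : Type*} [Field L] [AddCommGroup M] [Module L M]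
    (f : ι → M) (T : Finset ι) (c : ι → L) :
    ∃ S ⊆ T, ∃ d : ι → L, LinearIndepOn L f (S : Set ι) ∧ (∀ j ∈ S, d j ≠ 0) ∧
      ∑ j ∈ S, d j • f j = ∑ j ∈ T, c j • f j := by
  classical
  induction T using Finset.strongInduction generalizing c with
  | H T ih =>
    have key : ∀ k ∈ T, ∀ c' : ι → L, c' k = 0 → ∑ j ∈ T, c' j • f j = ∑ j ∈ T, c j • f j →
        ∃ S ⊆ T, ∃ d : ι → L, LinearIndepOn L f (S : Set ι) ∧ (∀ j ∈ S, d j ≠ 0) ∧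
          ∑ j ∈ S, d j • f j = ∑ j ∈ T, c j • f j := fun k hk c' hk0 hc' => by
      obtain ⟨S, hST, d, h1, h2, h3⟩ := ih _ (Finset.erase_ssubset hk) c'
      refine ⟨S, hST.trans (Finset.erase_subset _ _), d, h1, h2, ?_⟩
      rw [h3, ← hc', ← Finset.add_sum_erase _ _ hk, hk0, zero_smul, zero_add]
    by_cases h0 : ∀ j ∈ T, c j ≠ 0
    · by_cases hT : LinearIndepOn L f (T : Set ι)
      · exact ⟨T, subset_rfl, c, hT, h0, rfl⟩
      · rw [linearIndepOn_finset_iff] at hT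
        push Not at hT
        obtain ⟨d, hd, k, hk, hdk⟩ := hT
        refine key k hk (fun j => c j - c k / d k * d j) (by simp [hdk]) ?_
        simp only [sub_smul, mul_smul, Finset.sum_sub_distrib, ← Finset.smul_sum, hd, smul_zero,
          sub_zero]
    · push Not at h0
      obtain ⟨k, hk, hk0⟩ := h0
      exact key k hk c hk0 rfl

namespace HahnSeries

variable {L : Type*} [Field L]

/-- A valuation bound for combinations of independent families extends to combinations of
arbitrary families all of whose partial sums are nonzero. -/
theorem addVal_sum_le_of_subsums_ne_zero {ι : Type*} (f : ι → HahnSeries ℚ L) (w : ι → ℚ)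
    (hw : ∀ j, addVal ℚ L (f j) = w j) (G : ℕ → ℚ) (hG0 : ∀ n, 0 ≤ G n)
    (hG : ∀ m n, G m + G n ≤ G (m + n))
    (hind : ∀ S : Finset ι, LinearIndepOn L f (S : Set ι) → ∀ c : ι → L, (∀ j ∈ S, c j ≠ 0) →
      ∀ j ∈ S, addVal ℚ L (∑ k ∈ S, c k • f k) ≤ ((w j + G S.card : ℚ) : WithTop ℚ))
    (c : ι → L) (T : Finset ι) (hT : ∀ U ⊆ T, U.Nonempty → ∑ k ∈ U, c k • f k ≠ 0) :
    ∀ j ∈ T, addVal ℚ L (∑ k ∈ T, c k • f k) ≤ ((w j + G T.card : ℚ) : WithTop ℚ) := by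
  classical
  have hmono : ∀ m n, m ≤ n → G m ≤ G n := fun m n hmn => by
    obtain ⟨k, rfl⟩ := Nat.exists_eq_add_of_le hmn
    linarith [hG m k, hG0 k]
  induction T using Finset.strongInduction with
  | H T ih =>
    intro j hj
    obtain ⟨S, hST, d, hS, hd, hsum⟩ := exists_linearIndepOn_sum_eq f T c
    have hF0 := hT T subset_rfl ⟨j, hj⟩
    have hSne : S.Nonempty := Finset.nonempty_iff_ne_empty.2 fun h => hF0 (by
      rw [← hsum, h, Finset.sum_empty])
    obtain ⟨i, hi, himin⟩ := S.exists_min_image w hSne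
    have h1 := hind S hS d hd i hi
    rw [hsum] at h1
    rcases le_or_gt (w i) (w j) with hij | hij
    · refine h1.trans (WithTop.coe_le_coe.2 ?_)
      linarith [hmono _ _ (Finset.card_le_card hST)]
    -- The terms cheaper than everything in `S`. They are disjoint from `S`, so the two
    -- cardinalities add up to at most that of `T`.
    set T' := T.filter fun k => w k < w i with hT'
    have hjT' : j ∈ T' := Finset.mem_filter.2 ⟨hj, hij⟩
    have hT'T : T' ⊆ T := Finset.filter_subset _ _
    have hss : T' ⊂ T := (Finset.ssubset_iff_of_subset hT'T).2
      ⟨i, hST hi, fun h => lt_irrefl _ (Finset.mem_filter.1 h).2⟩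
    have hcard : T'.card + S.card ≤ T.card := by
      rw [← Finset.card_union_of_disjoint]
      · exact Finset.card_le_card (Finset.union_subset hT'T hST)
      · exact Finset.disjoint_left.2 fun k hk hkS =>
          (himin k hkS).not_gt (Finset.mem_filter.1 hk).2
    have h2 := ih T' hss (fun U hU => hT U (hU.trans hT'T)) j hjT'
    -- Either the partial sum over `T'` dominates the remaining terms and decides the valuation, or
    -- `w i ≤ w j + G T'.card` and the two gaps combine by superadditivity.
    rcases lt_or_ge (addVal ℚ L (∑ k ∈ T', c k • f k)) ((w i : ℚ) : WithTop ℚ) with hlt | hge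
    · have h3 : ((w i : ℚ) : WithTop ℚ) ≤ addVal ℚ L (∑ k ∈ T \ T', c k • f k) := by
        refine AddValuation.map_le_sum _ fun k hk => ?_
        rw [Finset.mem_sdiff, hT', Finset.mem_filter, not_and] at hk
        have h4 : w i ≤ w k := not_lt.1 (hk.2 hk.1)
        rw [addVal_apply]
        refine le_trans ?_ (orderTop_le_orderTop_smul _ _)
        rw [← addVal_apply, hw]
        exact WithTop.coe_le_coe.2 h4
      rw [← Finset.sum_sdiff hT'T, AddValuation.map_add_eq_of_lt_right _ (hlt.trans_le h3)]
      refine h2.trans (WithTop.coe_le_coe.2 ?_)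
      linarith [hmono _ _ (Finset.card_le_card hT'T)]
    · have h3 := WithTop.coe_le_coe.1 (hge.trans h2)
      refine h1.trans (WithTop.coe_le_coe.2 ?_)
      linarith [hG T'.card S.card, hmono _ _ hcard]

variable [CharZero L]

theorem addVal_sum_monomials_le {g : L[X][Y]} {φ : HahnSeries ℚ L} (hg : Irreducible g)
    (hφ : evalAt φ g = 0) {v : ℚ} (hv : addVal ℚ L φ = v) {dX dY : ℕ}
    (hgd : BidegreeLE dX dY g) (hdY : 1 ≤ g.natDegree) {ι : Type*} (α β : ι → ℕ) (c : ι → L)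
    (T : Finset ι) (hT : ∀ U ⊆ T, U.Nonempty →
      ∑ k ∈ U, c k • (single (1 : ℚ) (1 : L) ^ α k * φ ^ β k) ≠ 0) (j : ι) (hj : j ∈ T) :
    addVal ℚ L (∑ k ∈ T, c k • (single (1 : ℚ) (1 : L) ^ α k * φ ^ β k)) ≤
      ((α j + v * β j + gapConstant dX dY v * ((T.card : ℚ) - 1) ^ 2 : ℚ) : WithTop ℚ) := by
  have hC : 0 ≤ gapConstant dX dY v := by
    have h1 : (1 : ℚ) ≤ dY := by exact_mod_cast hdY.trans hgd.1
    have h2 : 0 ≤ (2 * (dY : ℚ) - 1) * -min 0 v :=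
      mul_nonneg (by linarith) (neg_nonneg.2 (min_le_left 0 v))
    have h3 : (0 : ℚ) ≤ 2 * dX * dY := by positivity
    rw [gapConstant]
    linarith
  have hcard : ∀ S : Finset ι, S.Nonempty → ((S.card - 1 : ℕ) : ℚ) = (S.card : ℚ) - 1 :=
    fun S hS => by rw [Nat.cast_sub hS.card_pos, Nat.cast_one]
  have := addVal_sum_le_of_subsums_ne_zero
    (fun k => single (1 : ℚ) (1 : L) ^ α k * φ ^ β k) (fun k => α k + v * β k) (fun k => by
      rw [AddValuation.map_mul, addVal_pow_eq addVal_single_one, addVal_pow_eq hv,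
        ← WithTop.coe_add]
      congr 1
      -- Truncated subtraction makes the value at `n = 0` vanish; with rational subtraction it would
      -- be `C`, and superadditivity would fail when `C > 0`.
      ring) (fun n => gapConstant dX dY v * ((n - 1 : ℕ) : ℚ) ^ 2) (fun n => by positivity)
    (fun m n => by
      rw [← mul_add]
      refine mul_le_mul_of_nonneg_left ?_ hC
      have h1 : (m - 1) + (n - 1) ≤ m + n - 1 := by omega
      have h2 : (m - 1) ^ 2 + (n - 1) ^ 2 ≤ (m + n - 1) ^ 2 := by nlinarith
      exact_mod_cast h2)
    (fun S hS d hd i hi => by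
      have hS' : LinearIndependent L fun k : Fin S.card =>
          single (1 : ℚ) (1 : L) ^ α (S.equivFin.symm k) * φ ^ β (S.equivFin.symm k) :=
        LinearIndependent.comp hS _ S.equivFin.symm.injective
      have h1 := addVal_sum_le hg hφ hv hgd hdY (fun k => α (S.equivFin.symm k))
        (fun k => β (S.equivFin.symm k)) hS' (fun k => d (S.equivFin.symm k))
        (S.equivFin ⟨i, hi⟩) (by simpa using hd i hi)
      rw [Equiv.symm_apply_apply, Equiv.sum_comp S.equivFin.symm (fun k : S =>
        d k • (single (1 : ℚ) (1 : L) ^ α k * φ ^ β k)), Finset.sum_coe_sort S (fun k =>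
        d k • (single (1 : ℚ) (1 : L) ^ α k * φ ^ β k))] at h1
      rwa [hcard S ⟨i, hi⟩])
    c T hT j hj
  rwa [hcard T ⟨j, hj⟩] at this

end HahnSeries

/-! ### Passing to an irreducible factor over `L`, and comparison of constants. -/

namespace Polynomial

theorem coeff_coeff_swap {R : Type*} [CommRing R] (P : R[X][Y]) (i j : ℕ) :
    ((Bivariate.swap P).coeff i).coeff j = (P.coeff j).coeff i := by
  induction P using Polynomial.induction_on' with
  | add P Q hP hQ => simp only [map_add, coeff_add, hP, hQ]
  | monomial n p =>
    induction p using Polynomial.induction_on' with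
    | add p q hp hq => simp only [map_add, coeff_add, hp, hq]
    | monomial m r =>
      rw [Bivariate.swap_monomial_monomial]
      simp only [coeff_monomial]
      split_ifs <;> simp_all [coeff_monomial]

theorem natDegree_swap_le_iff {R : Type*} [CommRing R] (P : R[X][Y]) (a : ℕ) :
    (Bivariate.swap P).natDegree ≤ a ↔ ∀ j, (P.coeff j).natDegree ≤ a := by
  constructor
  · intro h j
    refine natDegree_le_iff_coeff_eq_zero.2 fun N hN => ?_
    rw [← coeff_coeff_swap, coeff_eq_zero_of_natDegree_lt (h.trans_lt hN), coeff_zero]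
  · intro h
    refine natDegree_le_iff_coeff_eq_zero.2 fun N hN => ?_
    ext j
    rw [coeff_coeff_swap, coeff_eq_zero_of_natDegree_lt ((h j).trans_lt hN), coeff_zero]

/-- Exchanging the variables turns the `X`-degree into a `natDegree`, which is monotone under
divisibility over a domain. -/
theorem BidegreeLE.of_dvd {R : Type*} [CommRing R] [IsDomain R] {a b : ℕ} {P Q : R[X][Y]}
    (h : BidegreeLE a b Q) (hPQ : P ∣ Q) (hQ : Q ≠ 0) : BidegreeLE a b P := by
  refine ⟨(natDegree_le_of_dvd hPQ hQ).trans h.1, (natDegree_swap_le_iff P a).1 ?_⟩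
  have hdvd : Bivariate.swap P ∣ Bivariate.swap Q := by
    obtain ⟨Q', rfl⟩ := hPQ
    exact ⟨Bivariate.swap Q', map_mul _ _ _⟩
  have hne : Bivariate.swap Q ≠ 0 := fun h0 =>
    hQ (Bivariate.swap.injective (h0.trans (map_zero _).symm))
  exact (natDegree_le_of_dvd hdvd hne).trans ((natDegree_swap_le_iff Q a).2 h.2)

end Polynomial

theorem exists_irreducible_dvd_map_eq_zero {R S : Type*} [CommRing R] [IsDomain R]
    [UniqueFactorizationMonoid R] [CommRing S] [IsDomain S] (e : R →+* S)
    {r : R} (hr : r ≠ 0) (he : e r = 0) : ∃ p, Irreducible p ∧ p ∣ r ∧ e p = 0 := by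
  induction r using WfDvdMonoid.induction_on_irreducible with
  | zero => exact absurd rfl hr
  | unit u hu => exact absurd he (hu.map e).ne_zero
  | mul a i ha hi ih =>
    rw [map_mul, mul_eq_zero] at he
    rcases he with he | he
    · exact ⟨i, hi, dvd_mul_right _ _, he⟩
    · obtain ⟨p, hp, hpa, hep⟩ := ih ha he
      exact ⟨p, hp, hpa.mul_left _, hep⟩

/-- With `n = ℓ - 1`, the right side minus the left is `2 e1 + e2 / 2` when `v ≥ 0` and `e1 + e2`
when `v ≤ 0`, for the nonnegative `e1`, `e2` of each case. -/
theorem gapConstant_mul_le_gammaBound {dX dY ℓ : ℕ} {v : ℚ} (hv : |v| ≤ dX) (hdY : 1 ≤ dY)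
    (hℓ : 1 ≤ ℓ) :
    HahnSeries.gapConstant dX dY v * ((ℓ : ℚ) - 1) ^ 2 ≤ gammaBound dX dY v ℓ := by
  obtain ⟨n, rfl⟩ := Nat.exists_eq_add_of_le' hℓ
  rw [HahnSeries.gapConstant, gammaBound]
  push_cast
  obtain ⟨h1, h2⟩ := abs_le.1 hv
  have hb : (1 : ℚ) ≤ dY := by exact_mod_cast hdY
  have hn : (0 : ℚ) ≤ n := by positivity
  have hn2 : (n : ℚ) ≤ n ^ 2 := by
    exact_mod_cast Nat.le_self_pow two_ne_zero n
  generalize (n : ℚ) = n at *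
  generalize (dX : ℚ) = a at *
  generalize (dY : ℚ) = b at *
  have ha : 0 ≤ a := (abs_nonneg v).trans hv
  rcases le_total 0 v with h | h
  · rw [min_eq_left h]
    have e1 : 0 ≤ (a * n ^ 2) * (b - 1) := mul_nonneg (by positivity) (by linarith)
    have e2 : 0 ≤ n * (n + 1) * (a - v) := mul_nonneg (by positivity) (by linarith)
    nlinarith
  · rw [min_eq_right h]
    have e1 : 0 ≤ (a + v) * (2 * b * n ^ 2 - 1 / 2 * n * (3 * n - 1)) :=
      mul_nonneg (by linarith) (by nlinarith [mul_nonneg (sq_nonneg n) (sub_nonneg.2 hb)])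
    have e2 : 0 ≤ -v * n := mul_nonneg (by linarith) hn
    nlinarith

/-! ### Puiseux series over `K` inside Hahn series over `L`, and the conclusion. -/

namespace PuiseuxSeries

variable {K L : Type*} [Field K] [Field L] [Algebra K L]

theorem coe_algebraMap (c : K) :
    ((algebraMap K (PuiseuxSeries L) c : PuiseuxSeries L) : HahnSeries ℚ L) =
      algebraMap L _ (algebraMap K L c) := rfl

theorem coe_smul (c : K) (ψ : PuiseuxSeries L) :
    ((c • ψ : PuiseuxSeries L) : HahnSeries ℚ L) =
      algebraMap K L c • (ψ : HahnSeries ℚ L) := by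
  rw [Algebra.smul_def, Algebra.smul_def]
  rfl

theorem coe_subst (P : K[X][Y]) (φ : PuiseuxSeries L) :
    (subst P φ : HahnSeries ℚ L) =
      HahnSeries.evalAt (φ : HahnSeries ℚ L) (P.map (mapRingHom (algebraMap K L))) := by
  have : ((PuiseuxSeries L).subtype.comp (aevalAeval (X : PuiseuxSeries L) φ : K[X][Y] →ₐ[K] _).toRingHom)
      = (HahnSeries.evalAt (φ : HahnSeries ℚ L)).toRingHom.comp
        (mapRingHom (mapRingHom (algebraMap K L))) := by
    refine Polynomial.ringHom_ext' (Polynomial.ringHom_ext' (RingHom.ext fun c => ?_) ?_) ?_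
    · change ((aevalAeval (X : PuiseuxSeries L) φ (CC c : K[X][Y]) : PuiseuxSeries L) :
        HahnSeries ℚ L) = HahnSeries.evalAt (φ : HahnSeries ℚ L)
          ((CC c : K[X][Y]).map (mapRingHom (algebraMap K L)))
      rw [← coe_algebraMap_eq_CC, AlgHom.commutes, coe_algebraMap, coe_algebraMap_eq_CC, map_C,
        coe_mapRingHom, map_C, HahnSeries.evalAt_CC]
    · change ((aevalAeval (X : PuiseuxSeries L) φ (C Polynomial.X : K[X][Y]) : PuiseuxSeries L) :
        HahnSeries ℚ L) = HahnSeries.evalAt (φ : HahnSeries ℚ L)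
          ((C Polynomial.X : K[X][Y]).map (mapRingHom (algebraMap K L)))
      rw [aevalAeval_X, map_C, coe_mapRingHom, map_X, HahnSeries.evalAt_C, aeval_X]
      rfl
    · change ((aevalAeval (X : PuiseuxSeries L) φ (Y : K[X][Y]) : PuiseuxSeries L) :
        HahnSeries ℚ L) = HahnSeries.evalAt (φ : HahnSeries ℚ L)
          ((Y : K[X][Y]).map (mapRingHom (algebraMap K L)))
      rw [aevalAeval_Y, map_X, HahnSeries.evalAt_Y]
  exact congrArg (fun e => e P) this

end PuiseuxSeries

end

theorem mainTheorem2 {K L : Type*} [Field K] [CharZero K] [Field L] [Algebra K L]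
    [IsAlgClosure K L]
    (φ : PuiseuxSeries L) (v : ℚ) (hv : PuiseuxSeries.val φ = v)
    (g : K[X][Y]) (hg : PuiseuxSeries.IsMinimalPolynomial g φ)
    (dX dY : ℕ) (hdX : degX g = dX) (hdY : g.natDegree = dY)
    (ℓ : ℕ) [NeZero ℓ] (c : Fin ℓ → K) (α β : Fin ℓ → ℕ)
    (hc : ∀ j, c j ≠ 0) (hαβ : Function.Injective fun j => (α j, β j))
    (f : K[X][Y]) (hf : f = ∑ j, CC (c j) * C X ^ α j * Y ^ β j)
    (hli : LinearIndependent K fun j =>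
      (PuiseuxSeries.X ^ α j * φ ^ β j : PuiseuxSeries L)) :
    PuiseuxSeries.val (PuiseuxSeries.subst f φ) ≤
      ((Finset.univ.inf' Finset.univ_nonempty (fun j => (α j : ℚ) + v * β j) +
        gammaBound dX dY v ℓ : ℚ) : WithTop ℚ) := by
  have hL : CharZero L := charZero_of_injective_algebraMap (algebraMap K L).injective
  set Φ : HahnSeries ℚ L := (φ : HahnSeries ℚ L) with hΦ
  have hv' : HahnSeries.addVal ℚ L Φ = v := (HahnSeries.addVal_apply).trans hv
  set G : L[X][Y] := g.map (mapRingHom (algebraMap K L)) with hG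
  have hGinj : Function.Injective (mapRingHom (algebraMap K L)) :=
    map_injective _ (algebraMap K L).injective
  have hG0 : G ≠ 0 := (Polynomial.map_ne_zero_iff hGinj).2 hg.1.ne_zero
  have hGφ : HahnSeries.evalAt Φ G = 0 := by
    rw [← PuiseuxSeries.coe_subst, hg.2]
    rfl
  have hGd : BidegreeLE dX dY G := by
    refine ⟨natDegree_map_le.trans hdY.le, fun j => ?_⟩
    rw [hG, coeff_map, coe_mapRingHom]
    refine natDegree_map_le.trans ?_
    by_cases hj : j ∈ g.support
    · rw [← hdX]
      exact Finset.le_sup (f := fun j => (g.coeff j).natDegree) hj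
    · rw [notMem_support_iff.1 hj]
      simp
  obtain ⟨h, hirr, hdvd, hhφ⟩ := exists_irreducible_dvd_map_eq_zero
    (HahnSeries.evalAt Φ).toRingHom hG0 hGφ
  replace hhφ : HahnSeries.evalAt Φ h = 0 := hhφ
  have hhd := hGd.of_dvd hdvd hG0
  -- A factor free of `Y` would be a nonzero polynomial in `X` vanishing at the series `X`.
  have hh1 : 1 ≤ h.natDegree := Nat.one_le_iff_ne_zero.2 fun h0 => by
    obtain ⟨p, rfl⟩ := natDegree_eq_zero.1 h0
    rw [HahnSeries.evalAt_C] at hhφ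
    refine hirr.ne_zero ?_
    rw [HahnSeries.aeval_single_one_injective (hhφ.trans (map_zero _).symm), C_0]
  have habs := HahnSeries.abs_le_of_evalAt_eq_zero hv' hhd.2 hirr.ne_zero hhφ
  have hsum : ∀ U : Finset (Fin ℓ), ((∑ k ∈ U, c k • (PuiseuxSeries.X ^ α k * φ ^ β k) :
      PuiseuxSeries L) : HahnSeries ℚ L) = ∑ k ∈ U, algebraMap K L (c k) •
        (HahnSeries.single (1 : ℚ) (1 : L) ^ α k * Φ ^ β k) := fun U => by
    rw [AddSubmonoidClass.coe_finsetSum]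
    exact Finset.sum_congr rfl fun k _ => PuiseuxSeries.coe_smul _ _
  -- The only use of independence over `K`: the coefficients `c k` lie in `K` and are nonzero, so no
  -- nonempty partial sum vanishes.
  have hsub : ∀ U ⊆ (Finset.univ : Finset (Fin ℓ)), U.Nonempty → ∑ k ∈ U, algebraMap K L (c k) •
      (HahnSeries.single (1 : ℚ) (1 : L) ^ α k * Φ ^ β k) ≠ 0 := fun U _ ⟨k, hk⟩ h0 => by
    rw [← hsum, ZeroMemClass.coe_eq_zero] at h0
    exact hc k (linearIndependent_iff'.1 hli U c h0 k hk)
  obtain ⟨j, -, hj⟩ := Finset.exists_mem_eq_inf' (Finset.univ_nonempty (α := Fin ℓ))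
    (fun j => (α j : ℚ) + v * β j)
  have hmain := HahnSeries.addVal_sum_monomials_le hirr hhφ hv' hhd hh1 α β _ Finset.univ hsub j
    (Finset.mem_univ j)
  have hfφ : (PuiseuxSeries.subst f φ : HahnSeries ℚ L) = ∑ k, algebraMap K L (c k) •
      (HahnSeries.single (1 : ℚ) (1 : L) ^ α k * Φ ^ β k) := by
    rw [← hsum, hf, PuiseuxSeries.subst, map_sum]
    congr 1
    refine Finset.sum_congr rfl fun k _ => ?_
    rw [map_mul, map_mul, map_pow, map_pow, aevalAeval_X, aevalAeval_Y, ← coe_algebraMap_eq_CC,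
      AlgHom.commutes, Algebra.smul_def, mul_assoc]
  rw [← hfφ, HahnSeries.addVal_apply, Finset.card_univ, Fintype.card_fin] at hmain
  refine hmain.trans (WithTop.coe_le_coe.2 ?_)
  rw [hj]
  have := gapConstant_mul_le_gammaBound habs (hh1.trans hhd.1) (Nat.one_le_iff_ne_zero.2 (NeZero.ne ℓ))
  linarith
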